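/- Let $C$ be a commutative noetherian domain, let $G$ be a polycyclic-by-finite group acting on $C$ by ring automorphisms (the image of $c\in C$ under $g\in G$ is written $c^g$, with $c^{gh}=(c^h)^g$), and let $I$ be a prime ideal of $C$. Let $B=C\#G$ be the skew group ring, that is, the free left $C$-module with basis $G$ and multiplication $(rh)(sg)=(r\,s^h)(hg)$ for $r,s\in C$, $g,h\in G$, and let $R=\{b\in B\mid b\,IB\subseteq IB\}$ be the idealiser in $B$ of the right ideal $IB$. Put $K=\mathrm{Stab}_G(I)=\{g\in G\mid I^g=I\}$. A subgroup $H\le G$ is called complementary to $K$ if $H\cap K=\{1\}$ and $HK$ has finite index in $G$, in the sense that $G$ is a union of finitely many left translates $aHK$ (if $HK$ is a subgroup, this is the usual meaning). For a subgroup $H\le G$ and a point (prime ideal) $p\in\operatorname{Spec}C$, put $S_{H,p}=\{h\in H\mid I^h\subseteq p\}$. Suppose that $K$ has at least one complementary subgroup. Then the following are equivalent: (1) there exists a subgroup $H\le G$, complementary to $K$, such that $S_{H,p}$ is finite for all points $p\in\operatorname{Spec}C$; (2) $R$ is right noetherian; (3) for all subgroups $H\le G$ complementary to $K$ and all points $p\in\operatorname{Spec}C$,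 the set $S_{H,p}$ is finite. -/

import Mathlib

open scoped Pointwise

namespace IdealiserSkew

/-- A group is polycyclic if it has a finite subnormal series
`1 = G₀ ⊴ G₁ ⊴ ⋯ ⊴ Gₙ = G` all of whose factors `Gᵢ₊₁ / Gᵢ` are cyclic. -/
def IsPolycyclic (G : Type*) [Group G] : Prop :=
  ∃ (n : ℕ) (s : ℕ → Subgroup G), s 0 = ⊥ ∧ s n = ⊤ ∧
    ∀ i < n, s i ≤ s (i + 1) ∧
      ∃ _ : ((s i).subgroupOf (s (i + 1))).Normal,
        IsCyclic (s (i + 1) ⧸ (s i).subgroupOf (s (i + 1)))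

/-- A group is polycyclic-by-finite if it has a polycyclic normal subgroup of finite index. -/
def IsPolycyclicByFinite (G : Type*) [Group G] : Prop :=
  ∃ N : Subgroup G, N.Normal ∧ N.FiniteIndex ∧ IsPolycyclic N

/-- `H` is complementary to `K` in `G` if `H ∩ K = {1}` and `HK` has finite index in `G`, i.e.
finitely many left translates `a H K` cover `G`. If `HK` is a subgroup, this is the usual
finiteness of the index; the covering condition makes sense also if it is not a subgroup. -/
def IsComplementary {G : Type*} [Group G] (H K : Subgroup G) : Prop :=
  H ⊓ K = ⊥ ∧
    ∃ t : Finset G, ∀ g : G, ∃ a ∈ t, ∃ h ∈ H, ∃ k ∈ K, g = a * h * k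

/-- The idealiser `{b ∈ B | b J ⊆ J}` of a right ideal `J` of a ring `B`, as a subring of `B`.
Right ideals of `B` are submodules of `B` over the opposite ring `Bᵐᵒᵖ`. -/
def idealiser {B : Type*} [Ring B] (J : Submodule Bᵐᵒᵖ B) : Subring B where
  carrier := {b | ∀ x ∈ J, b * x ∈ J}
  mul_mem' := fun {a b} ha hb x hx => by
    rw [mul_assoc]
    exact ha _ (hb x hx)
  one_mem' := fun x hx => by rwa [one_mul]
  add_mem' := fun {a b} ha hb x hx => by
    rw [add_mul]
    exact J.add_mem (ha x hx) (hb x hx)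
  zero_mem' := fun x _ => by
    rw [zero_mul]
    exact J.zero_mem
  neg_mem' := fun {a} ha x hx => by
    rw [neg_mul]
    exact J.neg_mem (ha x hx)

/-- A ring is right noetherian if it is noetherian as a right module over itself. -/
def IsRightNoetherian (R : Type*) [Ring R] : Prop :=
  IsNoetherian Rᵐᵒᵖ R

section

variable {C G : Type*} [CommRing C] [Group G] [MulSemiringAction G C]

/-- The right ideal `I B` of the skew group ring `B = C # G` generated by an ideal `I` of `C`.
Here `SkewMonoidAlgebra C G` is the free left `C`-module on `G` with
`(r h) (s g) = (r (h • s)) (h g)`, and `c ∈ C` is identified with `c 1 ∈ B`. -/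
noncomputable def extendedRightIdeal (G : Type*) [Group G] [MulSemiringAction G C]
    (I : Ideal C) :
    Submodule (SkewMonoidAlgebra C G)ᵐᵒᵖ (SkewMonoidAlgebra C G) :=
  Submodule.span (SkewMonoidAlgebra C G)ᵐᵒᵖ
    ((fun c : C => SkewMonoidAlgebra.single (1 : G) c) '' (I : Set C))

/-- The set `S_{H,p} = {h ∈ H | I^h ⊆ p}`, where `I^h = h • I` is the image of `I` under `h`. -/
def transporterSet (I : Ideal C) (H : Subgroup G) (p : PrimeSpectrum C) : Set G :=
  {h | h ∈ H ∧ h • I ≤ p.asIdeal}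

end

end IdealiserSkew

open scoped Pointwise

/-! Write K for the stabiliser of I and T(p) = {g | g • I ⊆ p}. All three conditions are compared
with a fourth one that does not mention H: for every prime p, T(p) lies in a finite union of left
cosets fK. A complementary H meets each coset fK at most once, and finitely many translates of HK
cover G. Hence the fourth condition follows from finiteness of the sets S_{H,p} for one such H, and
implies it for all of them.

The fourth condition makes R right noetherian. For a right ideal L of R, the right ideal N = L(IB)
of B is finitely generated, and L/N consists of elements of B/N killed by I. These elements form a
noetherian module over C # K, which is contained in R (`isNoetherian_annihilatedBy_quotient`). This
rests on C # K and C # G being right noetherian, by a skew Laurent version of Hilbert's basis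
theorem.

Conversely, fix y ≠ 0 in I. The multiples yb, with the coefficients of b outside T(p) lying in p,
form a right ideal of R. The supports of finitely many generators yield the cosets that cover T(p)
(`exists_finite_transporter_subset`). -/

namespace IdealiserSkew

/-! ### Hilbert's basis theorem for skew Laurent extensions. -/

section HilbertBasis

variable {S A : Type*} [Ring S] [Ring A]

/-- The additive group of polynomials `∑_{i < n} t ^ i * f (s i)` of degree less than `n`. -/
def polyLT (f : S →+* A) (t : A) (n : ℕ) : AddSubgroup A :=
  AddSubgroup.closure {x | ∃ i < n, ∃ s, x = t ^ i * f s}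

lemma polyLT_mono (f : S →+* A) (t : A) {m n : ℕ} (h : m ≤ n) : polyLT f t m ≤ polyLT f t n :=
  AddSubgroup.closure_mono fun _ ⟨i, hi, s, hs⟩ => ⟨i, hi.trans_le h, s, hs⟩

lemma pow_mul_mem_polyLT (f : S →+* A) (t : A) {i n : ℕ} (h : i < n) (s : S) :
    t ^ i * f s ∈ polyLT f t n :=
  AddSubgroup.subset_closure ⟨i, h, s, rfl⟩

lemma mul_mem_polyLT_succ (f : S →+* A) (t : A) {n : ℕ} {a : A} (ha : a ∈ polyLT f t n) :
    t * a ∈ polyLT f t (n + 1) := by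
  induction ha using AddSubgroup.closure_induction with
  | mem x hx =>
    obtain ⟨i, hi, s, rfl⟩ := hx
    rw [← mul_assoc, ← pow_succ']
    exact pow_mul_mem_polyLT f t (by omega) s
  | zero => rw [mul_zero]; exact zero_mem _
  | add x y _ _ hx hy => rw [mul_add]; exact add_mem hx hy
  | neg x _ hx => rw [mul_neg]; exact neg_mem hx

lemma pow_mul_mem_polyLT_add (f : S →+* A) (t : A) {n : ℕ} {a : A} (ha : a ∈ polyLT f t n)
    (k : ℕ) : t ^ k * a ∈ polyLT f t (n + k) := by
  induction k with
  | zero => simpa using ha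
  | succ k ih =>
    rw [pow_succ', mul_assoc]
    exact mul_mem_polyLT_succ f t ih

lemma exists_eq_of_mem_polyLT_succ (f : S →+* A) (t : A) {n : ℕ} {a : A}
    (ha : a ∈ polyLT f t (n + 1)) : ∃ s, ∃ b ∈ polyLT f t n, a = t ^ n * f s + b := by
  induction ha using AddSubgroup.closure_induction with
  | mem x hx =>
    obtain ⟨i, hi, s, rfl⟩ := hx
    rcases Nat.lt_succ_iff_lt_or_eq.1 hi with h | rfl
    · exact ⟨0, _, pow_mul_mem_polyLT f t h s, by simp⟩
    · exact ⟨s, 0, zero_mem _, by simp⟩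
  | zero => exact ⟨0, 0, zero_mem _, by simp⟩
  | add x y _ _ hx hy =>
    obtain ⟨s, b, hb, rfl⟩ := hx
    obtain ⟨s', b', hb', rfl⟩ := hy
    exact ⟨s + s', b + b', add_mem hb hb', by rw [map_add, mul_add]; abel⟩
  | neg x _ hx =>
    obtain ⟨s, b, hb, rfl⟩ := hx
    exact ⟨-s, -b, neg_mem hb, by rw [map_neg, mul_neg]; abel⟩

lemma exists_map_mul_pow {f : S →+* A} {t : A} (h : ∀ s, ∃ s', f s * t = t * f s') (s : S)
    (n : ℕ) : ∃ s', f s * t ^ n = t ^ n * f s' := by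
  induction n with
  | zero => exact ⟨s, by simp⟩
  | succ n ih =>
    obtain ⟨s', hs'⟩ := ih
    obtain ⟨s'', hs''⟩ := h s'
    exact ⟨s'', by rw [pow_succ, ← mul_assoc, hs', mul_assoc, hs'', mul_assoc]⟩

lemma exists_pow_mul_map {f : S →+* A} {t : A} (h : ∀ s, ∃ s', t * f s = f s' * t) (s : S)
    (n : ℕ) : ∃ s', t ^ n * f s = f s' * t ^ n := by
  induction n with
  | zero => exact ⟨s, by simp⟩
  | succ n ih =>
    obtain ⟨s', hs'⟩ := ih
    obtain ⟨s'', hs''⟩ := h s'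
    exact ⟨s'', by rw [pow_succ', mul_assoc, hs', ← mul_assoc, hs'', mul_assoc]⟩

lemma map_mul_mem_polyLT {f : S →+* A} {t : A} (h : ∀ s, ∃ s', f s * t = t * f s') (s : S)
    {n : ℕ} {a : A} (ha : a ∈ polyLT f t n) : f s * a ∈ polyLT f t n := by
  induction ha using AddSubgroup.closure_induction with
  | mem x hx =>
    obtain ⟨i, hi, r, rfl⟩ := hx
    obtain ⟨s', hs'⟩ := exists_map_mul_pow h s i
    rw [← mul_assoc, hs', mul_assoc, ← map_mul]
    exact pow_mul_mem_polyLT f t hi _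
  | zero => rw [mul_zero]; exact zero_mem _
  | add x y _ _ hx hy => rw [mul_add]; exact add_mem hx hy
  | neg x _ hx => rw [mul_neg]; exact neg_mem hx

/-- The left ideal of leading coefficients of the elements of degree `n` of a left ideal `J`. -/
def leadingIdeal {f : S →+* A} {t : A} (h₁ : ∀ s, ∃ s', f s * t = t * f s')
    (h₂ : ∀ s, ∃ s', t * f s = f s' * t) (J : Ideal A) (n : ℕ) : Ideal S where
  carrier := {s | ∃ b ∈ polyLT f t n, t ^ n * f s + b ∈ J}
  zero_mem' := ⟨0, zero_mem _, by simp⟩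
  add_mem' := by
    rintro s s' ⟨b, hb, h⟩ ⟨b', hb', h'⟩
    refine ⟨b + b', add_mem hb hb', ?_⟩
    convert J.add_mem h h' using 1
    rw [map_add, mul_add]; abel
  smul_mem' := by
    rintro r s ⟨b, hb, h⟩
    obtain ⟨r', hr'⟩ := exists_pow_mul_map h₂ r n
    refine ⟨f r' * b, map_mul_mem_polyLT h₁ r' hb, ?_⟩
    convert J.mul_mem_left (f r') h using 1
    rw [smul_eq_mul, map_mul, mul_add, ← mul_assoc, ← mul_assoc, hr']

section

variable {f : S →+* A} {t : A} (h₁ : ∀ s, ∃ s', f s * t = t * f s')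
    (h₂ : ∀ s, ∃ s', t * f s = f s' * t)

lemma leadingIdeal_mono_left {J J' : Ideal A} (h : J ≤ J') (n : ℕ) :
    leadingIdeal h₁ h₂ J n ≤ leadingIdeal h₁ h₂ J' n :=
  fun _ ⟨b, hb, hs⟩ => ⟨b, hb, h hs⟩

/-- Left multiplication by `t` raises the degree and keeps the leading coefficient, because
coefficients stand to the right of the powers of `t`. -/
lemma leadingIdeal_mono (J : Ideal A) : Monotone (leadingIdeal h₁ h₂ J) := by
  refine monotone_nat_of_le_succ fun n => ?_
  rintro s ⟨b, hb, hs⟩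
  refine ⟨t * b, mul_mem_polyLT_succ f t hb, ?_⟩
  convert J.mul_mem_left t hs using 1
  rw [mul_add, pow_succ', mul_assoc]

/-- Subtracting an element of `J₀` with the same leading term lowers the degree. -/
lemma mem_of_leadingIdeal_le {J₀ J : Ideal A} (hJ : J₀ ≤ J)
    (h : ∀ n, leadingIdeal h₁ h₂ J n ≤ leadingIdeal h₁ h₂ J₀ n) (n : ℕ) :
    ∀ a ∈ polyLT f t n, a ∈ J → a ∈ J₀ := by
  induction n with
  | zero =>
    intro a ha _
    have : polyLT f t 0 = ⊥ := by
      rw [polyLT, AddSubgroup.closure_eq_bot_iff]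
      rintro x ⟨i, hi, _⟩
      omega
    rw [this, AddSubgroup.mem_bot] at ha
    rw [ha]
    exact zero_mem _
  | succ n ih =>
    intro a ha haJ
    obtain ⟨s, b, hb, rfl⟩ := exists_eq_of_mem_polyLT_succ f t ha
    obtain ⟨b₀, hb₀, hs₀⟩ := h n ⟨b, hb, haJ⟩
    have := ih (b - b₀) (sub_mem hb hb₀) (by
      convert J.sub_mem haJ (hJ hs₀) using 1
      abel)
    convert J₀.add_mem hs₀ this using 1
    abel

lemma exists_finite_leadingIdeal_le [IsNoetherianRing S] (J : Ideal A) (n : ℕ) :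
    ∃ T : Set A, T.Finite ∧ T ⊆ J ∧
      leadingIdeal h₁ h₂ J n ≤ leadingIdeal h₁ h₂ (Ideal.span T) n := by
  obtain ⟨F, hF⟩ := IsNoetherian.noetherian (leadingIdeal h₁ h₂ J n)
  have hmem : ∀ s : F, ∃ b ∈ polyLT f t n, t ^ n * f s + b ∈ J := fun s =>
    show (s : S) ∈ leadingIdeal h₁ h₂ J n from hF ▸ Submodule.subset_span s.2
  choose b hb hbJ using hmem
  refine ⟨Set.range fun s : F => t ^ n * f s + b s, Set.finite_range _, ?_, ?_⟩
  · rintro _ ⟨s, rfl⟩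
    exact hbJ s
  · rw [← hF, Submodule.span_le]
    intro s hs
    exact ⟨b ⟨s, hs⟩, hb _, Ideal.subset_span ⟨⟨s, hs⟩, rfl⟩⟩

end

/-- Hilbert's basis theorem for skew Laurent polynomials: if a unit `t` normalises the image of the
left noetherian ring `S`, and `A` is the sum of the `t ^ n * f S` with `n` an integer, then `A` is
left noetherian. -/
theorem isNoetherianRing_of_normalizing_unit [IsNoetherianRing S] (f : S →+* A) (t : Aˣ)
    (h₁ : ∀ s, ∃ s', f s * t = t * f s') (h₂ : ∀ s, ∃ s', t * f s = f s' * t)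
    (hgen : AddSubmonoid.closure
      {x : A | ∃ (n i : ℕ) (s : S), (t : A) ^ n * x = t ^ i * f s} = ⊤) :
    IsNoetherianRing A := by
  have hpoly : ∀ a : A, ∃ n k, (t : A) ^ n * a ∈ polyLT f (t : A) k := by
    intro a
    have ha : a ∈ (⊤ : AddSubmonoid A) := trivial
    rw [← hgen] at ha
    induction ha using AddSubmonoid.closure_induction with
    | mem x hx =>
      obtain ⟨n, i, s, h⟩ := hx
      exact ⟨n, i + 1, h ▸ pow_mul_mem_polyLT f _ (by omega) s⟩
    | zero => exact ⟨0, 0, by rw [mul_zero]; exact zero_mem _⟩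
    | add x y _ _ hx hy =>
      obtain ⟨n, k, h⟩ := hx
      obtain ⟨n', k', h'⟩ := hy
      refine ⟨n' + n, (k + n') + (k' + n), ?_⟩
      rw [mul_add]
      refine add_mem (polyLT_mono f _ (m := k + n') (by omega) ?_)
        (polyLT_mono f _ (m := k' + n) (by omega) ?_)
      · rw [pow_add, mul_assoc]
        exact pow_mul_mem_polyLT_add f _ h n'
      · rw [Nat.add_comm n' n, pow_add, mul_assoc]
        exact pow_mul_mem_polyLT_add f _ h' n
  refine ⟨fun J => ?_⟩
  obtain ⟨N, hN⟩ := monotone_stabilizes_iff_noetherian.2 ‹IsNoetherianRing S›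
    ⟨leadingIdeal h₁ h₂ J, leadingIdeal_mono h₁ h₂ J⟩
  -- Generators are needed only in degrees up to `N`, since later leading ideals of `J` equal the
  -- one in degree `N`.
  choose T hTfin hTJ hT using exists_finite_leadingIdeal_le h₁ h₂ J
  have hle : Ideal.span (⋃ n ∈ Set.Iic N, T n) ≤ J :=
    Ideal.span_le.2 (Set.iUnion₂_subset fun n _ => hTJ n)
  have hlead : ∀ n ≤ N, leadingIdeal h₁ h₂ J n ≤
      leadingIdeal h₁ h₂ (Ideal.span (⋃ n ∈ Set.Iic N, T n)) n := fun n hn =>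
    (hT n).trans (leadingIdeal_mono_left h₁ h₂
      (Ideal.span_mono (Set.subset_biUnion_of_mem (u := T) (Set.mem_Iic.2 hn))) n)
  suffices h : J = Ideal.span (⋃ n ∈ Set.Iic N, T n) by
    rw [h]
    exact Submodule.fg_span ((Set.finite_Iic N).biUnion fun n _ => hTfin n)
  refine le_antisymm (fun a ha => ?_) hle
  -- A power of the unit `t` clears the negative exponents of `a` and is cancelled once membership
  -- is known.
  obtain ⟨n, k, hk⟩ := hpoly a
  have := mem_of_leadingIdeal_le h₁ h₂ hle (fun n => ?_) k _ hk (Ideal.mul_mem_left J _ ha)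
  · have h := Ideal.mul_mem_left _ (((t ^ n)⁻¹ : Aˣ) : A) this
    rwa [← mul_assoc, ← Units.val_pow_eq_pow_val, Units.inv_mul, one_mul] at h
  · rcases le_total n N with hn | hn
    · exact hlead n hn
    · have : leadingIdeal h₁ h₂ J N = leadingIdeal h₁ h₂ J n := hN n hn
      rw [← this]
      exact (hlead N le_rfl).trans (leadingIdeal_mono h₁ h₂ _ hn)

end HilbertBasis

/-! ### Noetherianity of the skew group rings of subgroups. -/

open SkewMonoidAlgebra MulOpposite

lemma eq_sum_single {C G : Type*} [AddCommMonoid C] (b : SkewMonoidAlgebra C G) :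
    b = ∑ g ∈ b.support, single g (b.coeff g) := by
  conv_lhs => rw [← sum_single b, sum_def']

/-- `K ⊓ N` modulo the kernel of `φ` embeds in the cyclic group `Q`, so its image is cyclic; `t`
lifts a generator. -/
lemma exists_zpow_mul_mem_of_isCyclic {G Q : Type*} [Group G] [Group Q] [IsCyclic Q]
    (N : Subgroup G) (φ : N →* Q) (K : Subgroup G) :
    ∃ t ∈ K ⊓ N, ∀ q ∈ K ⊓ N, ∃ n : ℤ, q * t ^ n ∈ K ⊓ φ.ker.map N.subtype := by
  obtain ⟨⟨_, ⟨t, ht, rfl⟩⟩, hgen⟩ :=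
    IsCyclic.exists_generator (α := ((K.subgroupOf N).map φ : Subgroup Q))
  refine ⟨t, ⟨Subgroup.mem_subgroupOf.1 ht, t.2⟩, fun q hq => ?_⟩
  obtain ⟨n, hn⟩ := Subgroup.mem_zpowers_iff.1
    (hgen ⟨φ ⟨q, hq.2⟩, ⟨_, Subgroup.mem_subgroupOf.2 hq.1, rfl⟩⟩)
  have hn' : φ t ^ n = φ ⟨q, hq.2⟩ := congrArg Subtype.val hn
  refine ⟨-n, K.mul_mem hq.1 (K.zpow_mem (Subgroup.mem_subgroupOf.1 ht) _),
    ⟨⟨q, hq.2⟩ * t ^ (-n), ?_, by simp⟩⟩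
  rw [SetLike.mem_coe, MonoidHom.mem_ker, map_mul, map_zpow, ← hn', ← zpow_add, add_neg_cancel,
    zpow_zero]

variable {C G : Type*} [CommRing C] [Group G] [MulSemiringAction G C]

variable (C) in
/-- The opposite of the skew group ring `C # N` of a subgroup `N` of `G`, as a subring of the
opposite of `C # G`. -/
def suppSubring (N : Subgroup G) : Subring (SkewMonoidAlgebra C G)ᵐᵒᵖ where
  carrier := {a | ∀ g, a.unop.coeff g ≠ 0 → g ∈ N}
  mul_mem' := by
    classical
    intro a b ha hb g hg
    have := support_mul _ _ (mem_support_iff.2 hg)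
    obtain ⟨x, hx, y, hy, rfl⟩ := Finset.mem_mul.1 this
    exact N.mul_mem (hb _ (mem_support_iff.1 hx)) (ha _ (mem_support_iff.1 hy))
  one_mem' := by
    classical
    intro g hg
    rw [unop_one, coeff_one, Finsupp.single_apply] at hg
    obtain rfl : 1 = g := by by_contra h; simp [h] at hg
    exact N.one_mem
  add_mem' := by
    intro a b ha hb g hg
    by_contra h
    refine hg ?_
    rw [unop_add, coeff_add, Finsupp.add_apply, not_not.1 (mt (ha g) h), not_not.1 (mt (hb g) h),
      add_zero]
  zero_mem' := fun g hg => absurd rfl hg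
  neg_mem' := by
    intro a ha g hg
    refine ha g fun h => hg ?_
    rw [unop_neg, coeff_neg, Finsupp.neg_apply, h, neg_zero]

lemma op_single_mem_suppSubring {N : Subgroup G} {g : G} (hg : g ∈ N) (c : C) :
    op (single g c) ∈ suppSubring C N := by
  classical
  intro x hx
  rw [unop_op, coeff_single, Finsupp.single_apply] at hx
  obtain rfl : g = x := by by_contra h; simp [h] at hx
  exact hg

lemma suppSubring_mono {P Q : Subgroup G} (h : P ≤ Q) : suppSubring C P ≤ suppSubring C Q :=
  fun _ ha g hg => h (ha g hg)

lemma suppSubring_top : suppSubring C (⊤ : Subgroup G) = ⊤ :=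
  eq_top_iff.2 fun _ _ _ _ => trivial

@[elab_as_elim]
lemma suppSubring_induction {N : Subgroup G}
    {p : (a : (SkewMonoidAlgebra C G)ᵐᵒᵖ) → a ∈ suppSubring C N → Prop}
    (zero : p 0 (zero_mem _))
    (single : ∀ g (hg : g ∈ N) c, p (op (single g c)) (op_single_mem_suppSubring hg c))
    (add : ∀ a b ha hb, p a ha → p b hb → p (a + b) (add_mem ha hb))
    {a : (SkewMonoidAlgebra C G)ᵐᵒᵖ} (ha : a ∈ suppSubring C N) : p a ha := by
  have h : a = ∑ g ∈ a.unop.support, op (SkewMonoidAlgebra.single g (a.unop.coeff g)) := by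
    rw [← Finset.op_sum, ← eq_sum_single, op_unop]
  have : ∃ h, p (∑ g ∈ a.unop.support, op (SkewMonoidAlgebra.single g (a.unop.coeff g))) h :=
    Finset.sum_induction _ (fun a => ∃ h, p a h)
      (fun _ _ ⟨_, h⟩ ⟨_, h'⟩ => ⟨_, add _ _ _ _ h h'⟩) ⟨_, zero⟩
      fun g hg => ⟨_, single g (ha g (mem_support_iff.1 hg)) _⟩
  rw [← h] at this
  exact this.2

variable (C) in
/-- The units of the opposite of `C # G` given by the elements of `G`. -/
noncomputable def groupUnit (g : G) : (SkewMonoidAlgebra C G)ᵐᵒᵖˣ where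
  val := op (single g 1)
  inv := op (single g⁻¹ 1)
  val_inv := by rw [← op_mul, single_mul_single]; simp
  inv_val := by rw [← op_mul, single_mul_single]; simp

lemma groupUnit_mem {N : Subgroup G} {g : G} (hg : g ∈ N) :
    (groupUnit C g : (SkewMonoidAlgebra C G)ᵐᵒᵖ) ∈ suppSubring C N :=
  op_single_mem_suppSubring hg 1

lemma isNoetherianRing_suppSubring_bot [IsNoetherianRing C] :
    IsNoetherianRing (suppSubring C (⊥ : Subgroup G)) := by
  let f : C →+* (SkewMonoidAlgebra C G)ᵐᵒᵖ := singleOneRingHom.toOpposite fun x y => by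
    rw [Commute, SemiconjBy, ← map_mul, ← map_mul, mul_comm]
  have hf : ∀ c, f c ∈ suppSubring C (⊥ : Subgroup G) := fun c =>
    op_single_mem_suppSubring (one_mem _) c
  refine isNoetherianRing_of_surjective C _ (f.codRestrict _ hf) ?_
  rintro ⟨a, ha⟩
  refine ⟨a.unop.coeff 1, Subtype.ext (unop_injective ?_)⟩
  ext g
  change (single 1 (a.unop.coeff 1)).coeff g = a.unop.coeff g
  classical
  rw [coeff_single, Finsupp.single_apply]
  split_ifs with h
  · rw [h]
  · by_contra h'
    exact h (Subgroup.mem_bot.1 (ha g (Ne.symm h'))).symm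

lemma conj_mem_suppSubring {P : Subgroup G} {t : G} (h : ∀ p ∈ P, t⁻¹ * p * t ∈ P)
    {a : (SkewMonoidAlgebra C G)ᵐᵒᵖ} (ha : a ∈ suppSubring C P) :
    op (single t 1) * a * op (single t⁻¹ 1) ∈ suppSubring C P := by
  induction ha using suppSubring_induction with
  | zero => rw [mul_zero, zero_mul]; exact zero_mem _
  | single g hg c =>
    rw [← op_mul, ← op_mul, single_mul_single, single_mul_single, ← mul_assoc]
    exact op_single_mem_suppSubring (h g hg) _
  | add a b _ _ ha hb => rw [mul_add, add_mul]; exact add_mem ha hb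

/-- Writing q = (q t ^ n) t ^ (-n) exhibits the ring of `Q` as a skew Laurent extension of the ring
of `P`, with `t` as the normalising unit. -/
lemma isNoetherianRing_suppSubring_of_cyclic {P Q : Subgroup G} (hPQ : P ≤ Q) {t : G} (ht : t ∈ Q)
    (hn : ∀ p ∈ P, t⁻¹ * p * t ∈ P) (hn' : ∀ p ∈ P, t * p * t⁻¹ ∈ P)
    (hgen : ∀ q ∈ Q, ∃ n : ℤ, q * t ^ n ∈ P) [IsNoetherianRing (suppSubring C P)] :
    IsNoetherianRing (suppSubring C Q) := by
  let τ : (suppSubring C Q)ˣ :=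
    { val := ⟨_, groupUnit_mem ht⟩
      inv := ⟨_, groupUnit_mem (inv_mem ht)⟩
      val_inv := Subtype.ext (groupUnit C t).val_inv
      inv_val := Subtype.ext (groupUnit C t).inv_val }
  have hτ : ((τ : suppSubring C Q) : (SkewMonoidAlgebra C G)ᵐᵒᵖ) = op (single t 1) := rfl
  have hpow (n : ℕ) : (((τ : suppSubring C Q) ^ n : suppSubring C Q) :
      (SkewMonoidAlgebra C G)ᵐᵒᵖ) = op (single (t ^ n) 1) := by
    induction n with
    | zero => simp
    | succ n ih =>
      rw [pow_succ, Subring.coe_mul, ih, hτ, ← op_mul, single_mul_single]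
      simp [pow_succ']
  have e₁ : op (single t (1 : C)) * op (single t⁻¹ 1) = 1 := (groupUnit C t).val_inv
  have e₂ : op (single t⁻¹ (1 : C)) * op (single t 1) = 1 := (groupUnit C t).inv_val
  refine isNoetherianRing_of_normalizing_unit (Subring.inclusion (suppSubring_mono hPQ)) τ ?_ ?_ ?_
  · rintro ⟨a, ha⟩
    have := conj_mem_suppSubring (t := t⁻¹) (by simpa using hn') ha
    rw [inv_inv] at this
    refine ⟨⟨_, this⟩, Subtype.ext ?_⟩
    change a * op (single t 1) = op (single t 1) * (op (single t⁻¹ 1) * a * op (single t 1))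
    rw [← mul_assoc, ← mul_assoc, e₁, one_mul]
  · rintro ⟨a, ha⟩
    refine ⟨⟨_, conj_mem_suppSubring hn ha⟩, Subtype.ext ?_⟩
    change op (single t 1) * a = op (single t 1) * a * op (single t⁻¹ 1) * op (single t 1)
    rw [mul_assoc (_ * a), e₂, mul_one]
  · refine eq_top_iff.2 ?_
    rintro ⟨a, ha⟩ -
    induction ha using suppSubring_induction with
    | zero => exact zero_mem _
    | single q hq c =>
      obtain ⟨n, hn⟩ := hgen q hq
      -- The exponents are the positive and negative parts of `n`, as the basis theorem uses natural
      -- powers only.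
      refine AddSubmonoid.subset_closure ⟨n.toNat, (-n).toNat,
        ⟨_, op_single_mem_suppSubring hn c⟩, Subtype.ext ?_⟩
      rw [Subring.coe_mul, Subring.coe_mul, hpow, hpow]
      change op (single _ 1) * op (single q c) = op (single _ 1) * op (single _ c)
      rw [← op_mul, ← op_mul, single_mul_single, single_mul_single, mul_assoc q, ← zpow_natCast,
        ← zpow_natCast, ← zpow_add]
      simp only [smul_one, mul_one]
      congr 4
      omega
    | add a b _ _ iha ihb => exact add_mem iha ihb

/-- Representatives of the left cosets of `P` in `Q` span the larger ring as a module over the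
smaller one. -/
lemma isNoetherianRing_suppSubring_of_relIndex_ne_zero {P Q : Subgroup G} (hPQ : P ≤ Q)
    (hfin : P.relIndex Q ≠ 0) [IsNoetherianRing (suppSubring C P)] :
    IsNoetherianRing (suppSubring C Q) := by
  let f := Subring.inclusion (suppSubring_mono (C := C) hPQ)
  let _ : Module (suppSubring C P) (suppSubring C Q) := Module.compHom _ f
  have : IsScalarTower (suppSubring C P) (suppSubring C Q) (suppSubring C Q) :=
    ⟨fun a b c => mul_assoc (f a) b c⟩
  have : (P.subgroupOf Q).FiniteIndex := ⟨hfin⟩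
  let r : Q ⧸ P.subgroupOf Q → Q := Quotient.out
  suffices h : (⊤ : Submodule (suppSubring C P) (suppSubring C Q)) ≤
      Submodule.span _ (Set.range fun x => ⟨_, groupUnit_mem (C := C) (r x).2⟩) by
    have : Module.Finite (suppSubring C P) (suppSubring C Q) :=
      ⟨eq_top_iff.2 h ▸ Submodule.fg_span (Set.finite_range _)⟩
    exact isNoetherian_of_tower (suppSubring C P) inferInstance
  rintro ⟨a, ha⟩ -
  induction ha using suppSubring_induction with
  | zero => exact zero_mem _
  | single q hq c =>
    have hx : (r (⟨q, hq⟩ : Q) : G)⁻¹ * q ∈ P :=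
      Subgroup.mem_subgroupOf.1 (QuotientGroup.eq.1
        (QuotientGroup.out_eq' ((⟨q, hq⟩ : Q) : Q ⧸ P.subgroupOf Q)))
    have e : (⟨op (single q c), op_single_mem_suppSubring hq c⟩ : suppSubring C Q) =
        (⟨_, op_single_mem_suppSubring hx ((r (⟨q, hq⟩ : Q) : G)⁻¹ • c)⟩ : suppSubring C P) •
          ⟨_, groupUnit_mem (C := C) (r (⟨q, hq⟩ : Q)).2⟩ := by
      refine Subtype.ext ?_
      change op (single q c) = op (single _ _) * op (single _ 1)
      rw [← op_mul, single_mul_single, smul_inv_smul, one_mul, mul_inv_cancel_left]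
    rw [e]
    exact Submodule.smul_mem _ _ (Submodule.subset_span ⟨_, rfl⟩)
  | add a b _ _ iha ihb => exact add_mem iha ihb

lemma IsPolycyclicByFinite.isNoetherianRing_suppSubring [IsNoetherianRing C]
    (hG : IsPolycyclicByFinite G) (K : Subgroup G) : IsNoetherianRing (suppSubring C K) := by
  obtain ⟨N, -, hfin, n, s, h0, hn, hs⟩ := hG
  -- Intersecting the polycyclic series with `K` keeps each term normal in the next with cyclic
  -- factor, so each step is a skew Laurent extension.
  have key : ∀ i ≤ n,
      IsNoetherianRing (suppSubring C ((K.subgroupOf N ⊓ s i).map N.subtype)) := by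
    intro i
    induction i with
    | zero =>
      intro _
      rw [h0, inf_bot_eq, Subgroup.map_bot]
      exact isNoetherianRing_suppSubring_bot
    | succ i ih =>
      intro hi
      have := ih (by omega)
      obtain ⟨hle, hnormal, hcyc⟩ := hs i (by omega)
      obtain ⟨t, ht, htgen⟩ := exists_zpow_mul_mem_of_isCyclic (s (i + 1))
        (QuotientGroup.mk' ((s i).subgroupOf (s (i + 1)))) (K.subgroupOf N)
      rw [QuotientGroup.ker_mk', Subgroup.map_subgroupOf_eq_of_le hle] at htgen
      refine isNoetherianRing_suppSubring_of_cyclic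
        (Subgroup.map_mono (inf_le_inf_left _ hle)) (Subgroup.mem_map_of_mem _ ht) ?_ ?_ ?_
      · rintro _ ⟨p, hp, rfl⟩
        refine ⟨t⁻¹ * p * t, ⟨Subgroup.mul_mem _ (Subgroup.mul_mem _
          (Subgroup.inv_mem _ ht.1) hp.1) ht.1, ?_⟩, by simp⟩
        have := hnormal.conj_mem ⟨p, hle hp.2⟩ hp.2 ⟨t, ht.2⟩⁻¹
        rw [inv_inv] at this
        exact this
      · rintro _ ⟨p, hp, rfl⟩
        exact ⟨t * p * t⁻¹, ⟨Subgroup.mul_mem _ (Subgroup.mul_mem _ ht.1 hp.1)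
          (Subgroup.inv_mem _ ht.1),
          hnormal.conj_mem ⟨p, hle hp.2⟩ hp.2 ⟨t, ht.2⟩⟩, by simp⟩
      · rintro _ ⟨q, hq, rfl⟩
        obtain ⟨m, hm⟩ := htgen q hq
        exact ⟨m, q * t ^ m, hm, by simp⟩
  have := key n le_rfl
  rw [hn, inf_top_eq, Subgroup.subgroupOf_map_subtype] at this
  refine isNoetherianRing_suppSubring_of_relIndex_ne_zero (P := K ⊓ N) inf_le_left ?_
  rw [Subgroup.inf_relIndex_left]
  exact Subgroup.FiniteIndex.index_ne_zero

/-! ### Elements annihilated by I in right modules over C # G. -/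

lemma isNoetherian_of_forall_mem_of_map_eq_zero {S M M' : Type*} [Ring S] [AddCommGroup M]
    [AddCommGroup M'] [Module S M] [Module S M'] (φ : M →ₗ[S] M') {X W : Submodule S M}
    {Y : Submodule S M'} [IsNoetherian S W] [IsNoetherian S Y] (hY : ∀ x ∈ X, φ x ∈ Y)
    (hW : ∀ x ∈ X, φ x = 0 → x ∈ W) : IsNoetherian S X := by
  let ψ := φ.restrict hY
  let θ := (X.subtype ∘ₗ (LinearMap.ker ψ).subtype).codRestrict W
    fun x => hW _ x.1.2 (congrArg Subtype.val x.2)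
  have : IsNoetherian S (LinearMap.ker ψ) := isNoetherian_of_injective θ
    fun x y h => by
      have h' : ((x : X) : M) = (y : X) := congrArg W.subtype h
      exact Subtype.ext (Subtype.ext h')
  exact isNoetherian_of_range_eq_ker (LinearMap.ker ψ).subtype ψ (Submodule.range_subtype _)

variable (C G) in
/-- The embedding of the commutative ring `C` into the opposite of `C # G`. -/
noncomputable def coeffHom : C →+* (SkewMonoidAlgebra C G)ᵐᵒᵖ :=
  singleOneRingHom.toOpposite fun x y => by
    rw [Commute, SemiconjBy, ← map_mul, ← map_mul, mul_comm]

lemma coeffHom_apply (c : C) : coeffHom C G c = op (single 1 c) := rfl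

lemma coeffHom_mul_op_single (c : C) (g : G) (r : C) :
    coeffHom C G c * op (single g r) = op (single g r) * coeffHom C G (g • c) := by
  rw [coeffHom_apply, coeffHom_apply, ← op_mul, ← op_mul, single_mul_single, single_mul_single,
    one_smul, mul_one, one_mul, mul_comm]

/-- The set of `g` such that the image of `I` under `g` is contained in `p`. -/
def transporter (G : Type*) [Group G] [MulSemiringAction G C] (I p : Ideal C) : Set G :=
  {g | ∀ c ∈ I, g • c ∈ p}

lemma smul_le_iff_mem_transporter {I p : Ideal C} {g : G} :
    g • I ≤ p ↔ g ∈ transporter G I p := by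
  rw [Ideal.pointwise_smul_def, Ideal.map_le_iff_le_comap]
  rfl

lemma smul_mem_of_mem_stabilizer {I : Ideal C} {g : G} (hg : g ∈ MulAction.stabilizer G I) :
    g ∈ transporter G I I :=
  smul_le_iff_mem_transporter.1 (MulAction.mem_stabilizer_iff.1 hg).le

section Module

variable {M : Type*} [AddCommGroup M] [Module (SkewMonoidAlgebra C G)ᵐᵒᵖ M]

/-- The annihilator in `C` of an element of a right module over `C # G`. -/
noncomputable def coeffAnnihilator (m : M) : Ideal C :=
  Ideal.comap (coeffHom C G) (Ideal.torsionOf (SkewMonoidAlgebra C G)ᵐᵒᵖ M m)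

lemma mem_coeffAnnihilator {m : M} {c : C} :
    c ∈ coeffAnnihilator (G := G) m ↔ coeffHom C G c • m = 0 := Iff.rfl

lemma mem_coeffAnnihilator_groupUnit_smul {m : M} {g : G} {c : C} :
    c ∈ coeffAnnihilator (G := G) ((groupUnit C g : (SkewMonoidAlgebra C G)ᵐᵒᵖ) • m) ↔
      g • c ∈ coeffAnnihilator (G := G) m := by
  rw [mem_coeffAnnihilator, mem_coeffAnnihilator, ← mul_smul]
  have : coeffHom C G c * (groupUnit C g : (SkewMonoidAlgebra C G)ᵐᵒᵖ) = groupUnit C g *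
    coeffHom C G (g • c) := coeffHom_mul_op_single c g 1
  rw [this, mul_smul, ← Units.smul_def, smul_eq_zero_iff_eq]

lemma exists_le_coeffAnnihilator_isPrime [IsNoetherianRing C] {m : M} (hm : m ≠ 0) :
    ∃ x : M, (coeffAnnihilator (C := C) (G := G) x).IsPrime ∧
      coeffAnnihilator (C := C) (G := G) m ≤ coeffAnnihilator (G := G) x := by
  let _ : Module C M := Module.compHom M (coeffHom C G)
  have e (x : M) : (⊥ : Submodule C M).colon {x} = coeffAnnihilator (G := G) x := by
    ext c
    rw [Submodule.mem_colon_singleton]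
    rfl
  obtain ⟨P, hP, hle⟩ := exists_le_isAssociatedPrime_of_isNoetherianRing C m hm
  obtain ⟨hP, x, rfl⟩ := isAssociatedPrime_iff.1 hP
  rw [e] at hP hle
  rw [e] at hle
  exact ⟨x, hP, hle⟩

variable (M) in
/-- The elements of a right module over `C # G` annihilated by `I`, as a module over the skew group
ring of the stabiliser of `I`. -/
def annihilatedBy (I : Ideal C) : Submodule (suppSubring C (MulAction.stabilizer G I)) M where
  carrier := {m | ∀ c ∈ I, coeffHom C G c • m = 0}
  zero_mem' := fun _ _ => smul_zero _
  add_mem' := fun ha hb c hc => by rw [smul_add, ha c hc, hb c hc, add_zero]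
  smul_mem' := by
    rintro ⟨a, ha⟩ m hm c hc
    rw [Subring.smul_def]
    induction ha using suppSubring_induction with
    | zero => rw [zero_smul, smul_zero]
    | single g hg r =>
      rw [← mul_smul, coeffHom_mul_op_single, mul_smul,
        hm _ (smul_mem_of_mem_stabilizer hg c hc), smul_zero]
    | add a b _ _ ha hb => rw [add_smul, smul_add, ha, hb, add_zero]

/-- If the sum were nonzero, some prime annihilator `coeffAnnihilator x` would contain both `I` and
the intersection of the g⁻¹ • p for g in `s`, hence one g⁻¹ • p. Moving `x` by g⁻¹ and using
maximality of p turns this into equality, so g • I ⊆ p, against the choice of `s`. -/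
lemma sum_op_single_smul_eq_zero [IsNoetherianRing C] {I p : Ideal C} {m : M}
    (hp : coeffAnnihilator (G := G) m = p)
    (hmax : ∀ x : M, x ≠ 0 → p ≤ coeffAnnihilator (G := G) x → coeffAnnihilator (G := G) x = p)
    {s : Finset G} (hs : ∀ g ∈ s, g ∉ transporter G I p) (r : G → C)
    (hz : ∑ g ∈ s, op (single g (r g)) • m ∈ annihilatedBy (G := G) M I) :
    ∑ g ∈ s, op (single g (r g)) • m = 0 := by
  by_contra hne
  obtain ⟨x, hx, hle⟩ := exists_le_coeffAnnihilator_isPrime (C := C) (G := G) hne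
  have hx0 : x ≠ 0 := by
    rintro rfl
    exact hx.ne_top ((Ideal.eq_top_iff_one _).2 (mem_coeffAnnihilator.2 (smul_zero _)))
  have hinf : s.inf (fun g => p.comap (MulSemiringAction.toRingHom G C g)) ≤
      coeffAnnihilator (G := G) x := by
    refine le_trans (fun c hc => ?_) hle
    rw [mem_coeffAnnihilator, Finset.smul_sum]
    refine Finset.sum_eq_zero fun g hg => ?_
    have hgc : g • c ∈ coeffAnnihilator (G := G) m := hp ▸ (Submodule.mem_finsetInf.1 hc g hg)
    rw [← mul_smul, coeffHom_mul_op_single, mul_smul, mem_coeffAnnihilator.1 hgc, smul_zero]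
  obtain ⟨g, hg, hgx⟩ := hx.inf_le'.1 hinf
  have hgp : coeffAnnihilator (G := G) ((groupUnit C g⁻¹ : (SkewMonoidAlgebra C G)ᵐᵒᵖ) • x) =
      p := by
    refine hmax _ ?_ fun c hc => ?_
    · rwa [← Units.smul_def, Ne, smul_eq_zero_iff_eq]
    · rw [mem_coeffAnnihilator_groupUnit_smul]
      refine hgx ?_
      change g • g⁻¹ • c ∈ p
      rwa [smul_inv_smul]
  refine hs g hg fun c hc => ?_
  rw [← hgp, mem_coeffAnnihilator_groupUnit_smul, inv_smul_smul]
  exact hle (hz c hc)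

/-- The terms of `x` indexed by the transporter are killed by `I` one by one, so the remaining terms
have a sum killed by `I`, which vanishes. Splitting g = fk then puts the first group in the span
over C # K. -/
lemma mem_span_of_mem_annihilatedBy [IsNoetherianRing C] {I p : Ideal C} {m : M}
    (hp : coeffAnnihilator (G := G) m = p)
    (hmax : ∀ x : M, x ≠ 0 → p ≤ coeffAnnihilator (G := G) x → coeffAnnihilator (G := G) x = p)
    {F : Set G} (hF : transporter G I p ⊆ F * (MulAction.stabilizer G I : Set G)) {x : M}
    (hxm : x ∈ Submodule.span (SkewMonoidAlgebra C G)ᵐᵒᵖ {m})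
    (hx : x ∈ annihilatedBy (G := G) M I) :
    x ∈ Submodule.span (suppSubring C (MulAction.stabilizer G I))
      ((fun g => (groupUnit C g : (SkewMonoidAlgebra C G)ᵐᵒᵖ) • m) '' F) := by
  classical
  obtain ⟨a, rfl⟩ := Submodule.mem_span_singleton.1 hxm
  have h : a • m = ∑ g ∈ a.unop.support, op (single g (a.unop.coeff g)) • m := by
    rw [← Finset.sum_smul, ← Finset.op_sum, ← eq_sum_single, op_unop]
  rw [h, ← Finset.sum_filter_add_sum_filter_not _ (· ∈ transporter G I p)] at hx ⊢
  have hy : ∑ g ∈ a.unop.support with g ∈ transporter G I p, op (single g (a.unop.coeff g)) • m ∈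
      annihilatedBy (G := G) M I := by
    refine sum_mem fun g hg c hc => ?_
    have : g • c ∈ coeffAnnihilator (G := G) m := hp ▸ (Finset.mem_filter.1 hg).2 c hc
    rw [← mul_smul, coeffHom_mul_op_single, mul_smul, mem_coeffAnnihilator.1 this, smul_zero]
  have hz := sum_op_single_smul_eq_zero hp hmax (fun g hg => (Finset.mem_filter.1 hg).2) _
    ((Submodule.add_mem_iff_right _ hy).1 hx)
  rw [hz, add_zero]
  refine sum_mem fun g hg => ?_
  obtain ⟨f, hf, k, hk, rfl⟩ := hF (Finset.mem_filter.1 hg).2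
  have e : op (single (f * k) (a.unop.coeff (f * k))) • m =
      (⟨_, op_single_mem_suppSubring hk (f⁻¹ • a.unop.coeff (f * k))⟩ :
        suppSubring C (MulAction.stabilizer G I)) •
          (groupUnit C f : (SkewMonoidAlgebra C G)ᵐᵒᵖ) • m := by
    rw [Subring.smul_def, ← mul_smul]
    change _ = (op _ * op (single f 1)) • m
    rw [← op_mul, single_mul_single, one_mul, smul_inv_smul]
  exact e ▸ Submodule.smul_mem _ _ (Submodule.subset_span ⟨f, hf, rfl⟩)

theorem isNoetherian_annihilatedBy_quotient [IsNoetherianRing C] {I : Ideal C}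
    [IsNoetherianRing (suppSubring C (MulAction.stabilizer G I))]
    (hT : ∀ p : Ideal C, p.IsPrime →
      ∃ F : Set G, F.Finite ∧ transporter G I p ⊆ F * (MulAction.stabilizer G I : Set G))
    [IsNoetherian (SkewMonoidAlgebra C G)ᵐᵒᵖ M]
    (N : Submodule (SkewMonoidAlgebra C G)ᵐᵒᵖ M) :
    IsNoetherian (suppSubring C (MulAction.stabilizer G I))
      (annihilatedBy (G := G) (M ⧸ N) I) := by
  induction N using IsNoetherian.induction with
  | hgt N ih =>
  by_cases htop : ∃ x : M ⧸ N, x ≠ 0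
  swap
  · push Not at htop
    have : Subsingleton (annihilatedBy (G := G) (M ⧸ N) I) :=
      ⟨fun x y => Subtype.ext ((htop x).trans (htop y).symm)⟩
    exact isNoetherian_of_finite _ _
  obtain ⟨x₀, hx₀⟩ := htop
  -- An annihilator maximal among those of nonzero elements is prime; this provides the p to which
  -- `hT` applies.
  obtain ⟨_, ⟨m, hm, rfl⟩, hmax⟩ := set_has_maximal_iff_noetherian.2 ‹IsNoetherianRing C›
    {p | ∃ x : M ⧸ N, x ≠ 0 ∧ coeffAnnihilator (G := G) x = p} ⟨_, x₀, hx₀, rfl⟩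
  have hmax' : ∀ x : M ⧸ N, x ≠ 0 →
      coeffAnnihilator (G := G) m ≤ coeffAnnihilator (C := C) (G := G) x →
      coeffAnnihilator (C := C) (G := G) x = coeffAnnihilator (G := G) m := fun x hx hle =>
    (hle.eq_of_not_lt (hmax _ ⟨x, hx, rfl⟩)).symm
  have hprime : (coeffAnnihilator (C := C) (G := G) m).IsPrime := by
    obtain ⟨x, hx, hle⟩ := exists_le_coeffAnnihilator_isPrime (C := C) (G := G) hm
    rwa [hmax' x ?_ hle] at hx
    rintro rfl
    exact hx.ne_top ((Ideal.eq_top_iff_one _).2 (mem_coeffAnnihilator.2 (smul_zero _)))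
  obtain ⟨F, hFfin, hF⟩ := hT _ hprime
  obtain ⟨m₀, rfl⟩ := N.mkQ_surjective m
  let N' := N ⊔ Submodule.span (SkewMonoidAlgebra C G)ᵐᵒᵖ {m₀}
  have hlt : N < N' := by
    refine lt_of_le_of_ne le_sup_left fun h => hm ?_
    rw [Submodule.mkQ_apply, Submodule.Quotient.mk_eq_zero, h]
    exact Submodule.mem_sup_right (Submodule.mem_span_singleton_self _)
  have := ih N' hlt
  let φ := (Submodule.factor hlt.le).restrictScalars (suppSubring C (MulAction.stabilizer G I))
  have : IsNoetherian (suppSubring C (MulAction.stabilizer G I))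
      (Submodule.span (suppSubring C (MulAction.stabilizer G I))
        ((fun g => (groupUnit C g : (SkewMonoidAlgebra C G)ᵐᵒᵖ) • N.mkQ m₀) '' F)) :=
    isNoetherian_span_of_finite _ (hFfin.image _)
  -- In the passage from `M ⧸ N` to `M ⧸ N'`, the image is controlled by induction and the kernel
  -- lies in the submodule generated by `m₀`.
  refine isNoetherian_of_forall_mem_of_map_eq_zero φ
    (Y := annihilatedBy (G := G) (M ⧸ N') I) ?_ fun x hx h0 =>
      mem_span_of_mem_annihilatedBy rfl hmax' hF ?_ hx
  · intro x hx c hc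
    change _ • Submodule.factor hlt.le x = 0
    rw [← map_smul, hx c hc, map_zero]
  · change Submodule.factor hlt.le x = 0 at h0
    obtain ⟨y, rfl⟩ := N.mkQ_surjective x
    rw [Submodule.factor_mk, Submodule.mkQ_apply, Submodule.Quotient.mk_eq_zero] at h0
    obtain ⟨n, hn, z, hz, rfl⟩ := Submodule.mem_sup.1 h0
    obtain ⟨a, rfl⟩ := Submodule.mem_span_singleton.1 hz
    rw [map_add, map_smul, Submodule.mkQ_apply N n, (Submodule.Quotient.mk_eq_zero N).2 hn,
      zero_add]
    exact Submodule.smul_mem _ _ (Submodule.mem_span_singleton_self _)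

end Module

/-! ### A criterion for an idealiser to be right noetherian. -/

lemma exists_finite_span_image_eq {ι S M : Type*} [Ring S] [AddCommGroup M] [Module S M]
    (f : ι → M) (Z : Set ι) (h : (Submodule.span S (f '' Z)).FG) :
    ∃ E ⊆ Z, E.Finite ∧ Submodule.span S (f '' Z) = Submodule.span S (f '' E) := by
  obtain ⟨s, hsZ, hs⟩ := (Submodule.fg_span_iff_fg_span_finset_subset _).1 h
  exact (Set.exists_subset_image_finite_and
    (p := fun t => Submodule.span S (f '' Z) = Submodule.span S t)).1
    ⟨s, hsZ, s.finite_toSet, hs⟩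

lemma mem_extendedRightIdeal {I : Ideal C} {b : SkewMonoidAlgebra C G} :
    b ∈ extendedRightIdeal G I ↔ ∀ g, b.coeff g ∈ I := by
  constructor
  · intro hb
    induction hb using Submodule.span_induction with
    | mem x hx =>
      classical
      obtain ⟨c, hc, rfl⟩ := hx
      intro g
      rw [coeff_single, Finsupp.single_apply]
      split_ifs
      exacts [hc, zero_mem _]
    | zero => exact fun _ => zero_mem _
    | add x y _ _ hx hy =>
      intro g
      rw [coeff_add, Finsupp.add_apply]
      exact I.add_mem (hx g) (hy g)
    | smul a x _ hx =>
      intro g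
      rw [← op_unop a, op_smul_eq_mul, coeff_mul_left, sum_def']
      exact sum_mem fun h _ => I.mul_mem_right _ (hx h)
  · intro hb
    rw [eq_sum_single b]
    refine sum_mem fun g _ => ?_
    have : single g (b.coeff g) = op (single g (1 : C)) • single (1 : G) (b.coeff g) := by
      rw [op_smul_eq_mul, single_mul_single, one_mul, smul_one, mul_one]
    rw [this]
    exact Submodule.smul_mem _ _ (Submodule.subset_span ⟨_, hb g, rfl⟩)

lemma mem_idealiser_of_mem {B : Type*} [Ring B] {J : Submodule Bᵐᵒᵖ B} {b : B} (hb : b ∈ J) :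
    b ∈ idealiser J :=
  fun x _ => J.smul_mem (op x) hb

lemma unop_mem_idealiser {I : Ideal C} {a : (SkewMonoidAlgebra C G)ᵐᵒᵖ}
    (ha : a ∈ suppSubring C (MulAction.stabilizer G I)) :
    a.unop ∈ idealiser (B := SkewMonoidAlgebra C G) (extendedRightIdeal G I) := by
  induction ha using suppSubring_induction with
  | zero => exact zero_mem _
  | single g hg c =>
    intro x hx
    rw [mem_extendedRightIdeal] at hx ⊢
    intro h
    rw [unop_op, coeff_single_mul]
    exact I.mul_mem_left _ (smul_mem_of_mem_stabilizer hg _ (hx _))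
  | add a b _ _ ha hb => exact add_mem ha hb

section

variable {B : Type*} [Ring B] {J : Submodule Bᵐᵒᵖ B}

lemma exists_mem_span_fst_eq {E : Set (idealiser J × B)} (hE : ∀ z ∈ E, z.2 ∈ J) {x : Bᵐᵒᵖ}
    (hx : x ∈ Submodule.span Bᵐᵒᵖ ((fun z : idealiser J × B => op ((z.1 : B) * z.2)) '' E)) :
    ∃ l ∈ Submodule.span (idealiser J)ᵐᵒᵖ (Prod.fst '' E), x = op (l : B) := by
  -- The conclusion is not stable under scalars from B, so scalars may be applied to generators
  -- only: (l z) a = l (z a), with z a in `J`, hence in the idealiser.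
  induction hx using Submodule.closure_induction with
  | zero => exact ⟨0, zero_mem _, rfl⟩
  | add x y _ _ hx hy =>
    obtain ⟨l, hl, rfl⟩ := hx
    obtain ⟨l', hl', rfl⟩ := hy
    exact ⟨l + l', add_mem hl hl', rfl⟩
  | smul_mem a x hx =>
    obtain ⟨z, hz, rfl⟩ := hx
    refine ⟨op ⟨z.2 * a.unop, mem_idealiser_of_mem (J.smul_mem a (hE z hz))⟩ • z.1,
      Submodule.smul_mem _ _ (Submodule.subset_span ⟨z, hz, rfl⟩), ?_⟩
    exact congrArg op (mul_assoc _ _ _)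

lemma exists_mem_span_mkQ_eq (N : Ideal Bᵐᵒᵖ) {S : Subring Bᵐᵒᵖ}
    (hS : ∀ a ∈ S, a.unop ∈ idealiser J) {E : Set (idealiser J)} {v : Bᵐᵒᵖ ⧸ N}
    (hv : v ∈ Submodule.span S ((fun l : idealiser J => N.mkQ (op (l : B))) '' E)) :
    ∃ l ∈ Submodule.span (idealiser J)ᵐᵒᵖ E, v = N.mkQ (op (l : B)) := by
  induction hv using Submodule.span_induction with
  | mem v hv =>
    obtain ⟨l, hl, rfl⟩ := hv
    exact ⟨l, Submodule.subset_span hl, rfl⟩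
  | zero => exact ⟨0, zero_mem _, (map_zero N.mkQ).symm⟩
  | add x y _ _ hx hy =>
    obtain ⟨l, hl, rfl⟩ := hx
    obtain ⟨l', hl', rfl⟩ := hy
    exact ⟨l + l', add_mem hl hl', (map_add N.mkQ _ _).symm⟩
  | smul a x _ hx =>
    obtain ⟨l, hl, rfl⟩ := hx
    exact ⟨op ⟨_, hS a a.2⟩ • l, Submodule.smul_mem _ _ hl, (map_smul N.mkQ _ _).symm⟩

/-- If the elements of each cyclic right module `B / N` that are annihilated by the right ideal `J`
lie in a noetherian module over a subring of the idealiser, then the idealiser is right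
noetherian. -/
theorem isRightNoetherian_idealiser_of_forall_isNoetherian [IsNoetherianRing Bᵐᵒᵖ]
    {S : Subring Bᵐᵒᵖ} (hS : ∀ a ∈ S, a.unop ∈ idealiser J)
    (hX : ∀ N : Ideal Bᵐᵒᵖ, ∃ X : Submodule S (Bᵐᵒᵖ ⧸ N), IsNoetherian S X ∧
      ∀ b : B, (∀ z ∈ J, op (b * z) ∈ N) → N.mkQ (op b) ∈ X) :
    IsRightNoetherian (idealiser J) := by
  refine ⟨fun L => ?_⟩
  let f (z : idealiser J × B) : Bᵐᵒᵖ := op ((z.1 : B) * z.2)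
  -- `N` is the right ideal L J of B. Modulo `N`, every element of `L` is killed by `J`.
  let N : Ideal Bᵐᵒᵖ := Submodule.span _ (f '' (L : Set _) ×ˢ (J : Set B))
  obtain ⟨E₁, hE₁, hE₁fin, hN⟩ := exists_finite_span_image_eq f _ (IsNoetherian.noetherian N)
  obtain ⟨X, hXnoeth, hX⟩ := hX N
  let q (l : idealiser J) : Bᵐᵒᵖ ⧸ N := N.mkQ (op (l : B))
  have hq : Submodule.span S (q '' L) ≤ X := by
    rw [Submodule.span_le]
    rintro _ ⟨l, hl, rfl⟩
    exact hX _ fun z hz => Submodule.subset_span ⟨(l, z), ⟨hl, hz⟩, rfl⟩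
  obtain ⟨E₂, hE₂, hE₂fin, hE⟩ := exists_finite_span_image_eq q L
    (isNoetherian_submodule.1 hXnoeth _ hq)
  -- `E₂` generates `L` modulo `N`, and the left factors of the generators of `N` generate a right
  -- ideal of the idealiser containing `N`.
  have hL : L = Submodule.span _ (E₂ ∪ Prod.fst '' E₁) := by
    refine le_antisymm (fun l hl => ?_) (Submodule.span_le.2 (Set.union_subset hE₂ ?_))
    · have hl' : q l ∈ Submodule.span S (q '' E₂) := by
        rw [← hE]
        exact Submodule.subset_span ⟨l, hl, rfl⟩
      obtain ⟨l', hl', h⟩ := exists_mem_span_mkQ_eq N hS hl'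
      have h' : op (l : B) - op (l' : B) ∈ Submodule.span Bᵐᵒᵖ (f '' E₁) := by
        rw [← hN]
        exact (Submodule.Quotient.eq N).1 h
      obtain ⟨l₀, hl₀, h₀⟩ := exists_mem_span_fst_eq (fun z hz => (hE₁ hz).2) h'
      have : l = l' + l₀ := by
        refine Subtype.ext (op_injective ?_)
        change _ = op (l' : B) + op (l₀ : B)
        rw [← h₀, add_sub_cancel]
      rw [this, Submodule.span_union]
      exact Submodule.add_mem_sup hl' hl₀
    · rintro _ ⟨z, hz, rfl⟩
      exact (hE₁ hz).1
  rw [hL]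
  exact Submodule.fg_span (hE₂fin.union (hE₁fin.image _))

end

theorem isRightNoetherian_idealiser [IsNoetherianRing C] (hG : IsPolycyclicByFinite G)
    {I : Ideal C} (hT : ∀ p : Ideal C, p.IsPrime →
      ∃ F : Set G, F.Finite ∧ transporter G I p ⊆ F * (MulAction.stabilizer G I : Set G)) :
    IsRightNoetherian (idealiser (B := SkewMonoidAlgebra C G) (extendedRightIdeal G I)) := by
  have := hG.isNoetherianRing_suppSubring (C := C) (MulAction.stabilizer G I)
  have : IsNoetherianRing (SkewMonoidAlgebra C G)ᵐᵒᵖ := by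
    have := hG.isNoetherianRing_suppSubring (C := C) (⊤ : Subgroup G)
    rw [suppSubring_top] at this
    exact isNoetherianRing_of_surjective _ _ (Subring.subtype ⊤) fun x => ⟨⟨x, trivial⟩, rfl⟩
  refine isRightNoetherian_idealiser_of_forall_isNoetherian
    (S := suppSubring C (MulAction.stabilizer G I)) (fun a ha => unop_mem_idealiser ha)
    fun N => ⟨_, isNoetherian_annihilatedBy_quotient hT N, fun b hb c hc => ?_⟩
  exact (Submodule.Quotient.mk_eq_zero N).2 (hb _ (Submodule.subset_span ⟨c, hc, rfl⟩))

/-! ### From a right noetherian idealiser to finitely many cosets. -/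

/-- The right ideal of `R` consisting of its elements `y b` with `b` in `N`. -/
def leftMulSubmodule {B : Type*} [Ring B] {R : Subring B} (y : B) (N : AddSubgroup B)
    (hN : ∀ b ∈ N, ∀ r ∈ R, b * r ∈ N) : Submodule Rᵐᵒᵖ R where
  carrier := {r | ∃ b ∈ N, (r : B) = y * b}
  zero_mem' := ⟨0, N.zero_mem, (mul_zero _).symm⟩
  add_mem' := by
    rintro r r' ⟨b, hb, h⟩ ⟨b', hb', h'⟩
    exact ⟨b + b', N.add_mem hb hb', by rw [Subring.coe_add, h, h', mul_add]⟩
  smul_mem' := by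
    rintro s r ⟨b, hb, h⟩
    refine ⟨b * (s.unop : B), hN b hb _ s.unop.2, ?_⟩
    rw [← mul_assoc, ← h]
    rfl

/-- `E` consists of the cofactors of finitely many generators y b. It is fixed before `N'`, so `N'`
may be built from the supports of its elements. -/
lemma IsRightNoetherian.exists_finite_of_mul_mem {B : Type*} [Ring B] {R : Subring B}
    (hR : IsRightNoetherian R) (y : B) (N : AddSubgroup B) (hN : ∀ b ∈ N, ∀ r ∈ R, b * r ∈ N) :
    ∃ E : Set B, E.Finite ∧ E ⊆ N ∧ ∀ N' : AddSubgroup B, (∀ b ∈ N', ∀ r ∈ R, b * r ∈ N') →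
      E ⊆ N' → ∀ b ∈ N, y * b ∈ R → ∃ b' ∈ N', y * b = y * b' := by
  obtain ⟨s, hs⟩ := IsNoetherian.noetherian (self := hR) (leftMulSubmodule y N hN)
  have hb : ∀ r : s, ∃ b ∈ N, ((r : R) : B) = y * b := fun r =>
    show (r : R) ∈ leftMulSubmodule y N hN from hs ▸ Submodule.subset_span r.2
  choose b hbN hb using hb
  refine ⟨Set.range b, Set.finite_range b, Set.range_subset_iff.2 hbN,
    fun N' hN' hE c hc hyc => ?_⟩
  have hle : leftMulSubmodule y N hN ≤ leftMulSubmodule y N' hN' := by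
    rw [← hs, Submodule.span_le]
    exact fun r hr => ⟨b ⟨r, hr⟩, hE ⟨_, rfl⟩, hb ⟨r, hr⟩⟩
  exact hle (x := ⟨y * c, hyc⟩) ⟨c, hc, rfl⟩

/-- If the inclusion were strict, the ideals g⁻ⁿ • I would form a strictly ascending chain. -/
lemma mem_stabilizer_of_smul_le [IsNoetherianRing C] {I : Ideal C} {g : G} (h : g • I ≤ I) :
    g ∈ MulAction.stabilizer G I := by
  have hmono : Monotone fun n : ℕ => (g⁻¹ ^ n) • I := by
    refine monotone_nat_of_le_succ fun n => ?_
    rw [pow_succ, mul_smul, Ideal.pointwise_smul_le_pointwise_smul_iff]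
    rwa [← Ideal.pointwise_smul_le_pointwise_smul_iff (a := g), smul_inv_smul]
  obtain ⟨n, hn⟩ := monotone_stabilizes_iff_noetherian.2 ‹IsNoetherianRing C› ⟨_, hmono⟩
  have h' : (g⁻¹ ^ n) • I = (g⁻¹ ^ (n + 1)) • I := hn (n + 1) (Nat.le_succ n)
  rw [pow_succ, mul_smul, smul_left_cancel_iff] at h'
  rw [← inv_mem_iff]
  exact h'.symm

lemma coeff_mem_of_mem_idealiser [IsNoetherianRing C] {I : Ideal C} (hI : I.IsPrime)
    {r : SkewMonoidAlgebra C G}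
    (hr : r ∈ idealiser (B := SkewMonoidAlgebra C G) (extendedRightIdeal G I)) {g : G}
    (hg : g ∉ MulAction.stabilizer G I) : r.coeff g ∈ I := by
  obtain ⟨c, hc, hgc⟩ : ∃ c ∈ I, g • c ∉ I := by
    by_contra! h
    exact hg (mem_stabilizer_of_smul_le (smul_le_iff_mem_transporter.2 h))
  have := mem_extendedRightIdeal.1 (hr _ (Submodule.subset_span ⟨c, hc, rfl⟩)) g
  rw [coeff_mul_single_one] at this
  exact (hI.mem_or_mem this).resolve_right hgc

lemma mul_mem_transporter {I p : Ideal C} {g k : G} (hg : g ∈ transporter G I p)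
    (hk : k ∈ MulAction.stabilizer G I) : g * k ∈ transporter G I p := fun c hc => by
  rw [mul_smul]
  exact hg _ (smul_mem_of_mem_stabilizer hk c hc)

/-- A contribution to the coefficient at g ∉ D from u ∈ D involves the coefficient of `r` at u⁻¹g ∉
K. That coefficient lies in `I`, and u carries `I` into p. -/
lemma coeff_mul_mem_of_mem_idealiser [IsNoetherianRing C] {I p : Ideal C} (hI : I.IsPrime)
    {D : Set G} (hD : D ⊆ transporter G I p)
    (hDK : ∀ g ∈ D, ∀ k ∈ MulAction.stabilizer G I, g * k ∈ D)
    {b r : SkewMonoidAlgebra C G} (hb : ∀ g ∉ D, b.coeff g ∈ p)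
    (hr : r ∈ idealiser (B := SkewMonoidAlgebra C G) (extendedRightIdeal G I)) :
    ∀ g ∉ D, (b * r).coeff g ∈ p := by
  intro g hg
  rw [coeff_mul_left, sum_def']
  refine sum_mem fun u _ => ?_
  by_cases hu : u ∈ D
  · refine p.mul_mem_left _ (hD hu _ (coeff_mem_of_mem_idealiser hI hr fun hk => hg ?_))
    simpa using hDK u hu _ hk
  · exact p.mul_mem_right _ (hb u hu)

/-- The additive group of elements of `C # G` whose coefficients outside of `D` lie in `p`. -/
def coeffSubgroup (p : Ideal C) (D : Set G) : AddSubgroup (SkewMonoidAlgebra C G) where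
  carrier := {b | ∀ g ∉ D, b.coeff g ∈ p}
  zero_mem' := fun _ _ => p.zero_mem
  add_mem' := fun hb hb' g hg => by
    rw [coeff_add, Finsupp.add_apply]
    exact p.add_mem (hb g hg) (hb' g hg)
  neg_mem' := fun hb g hg => by
    rw [coeff_neg, Finsupp.neg_apply]
    exact p.neg_mem (hb g hg)

theorem exists_finite_transporter_subset [IsDomain C] [IsNoetherianRing C] {I : Ideal C}
    (hI : I.IsPrime)
    (hR : IsRightNoetherian (idealiser (B := SkewMonoidAlgebra C G) (extendedRightIdeal G I)))
    {p : Ideal C} (hp : p.IsPrime) :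
    ∃ F : Set G, F.Finite ∧ transporter G I p ⊆ F * (MulAction.stabilizer G I : Set G) := by
  rcases eq_or_ne I ⊥ with rfl | hI0
  -- For I = 0 there is no nonzero y, but K is all of G and one coset suffices.
  · refine ⟨{1}, Set.finite_singleton 1, fun g _ => ⟨1, rfl, g, ?_, one_mul g⟩⟩
    exact mem_stabilizer_of_smul_le (smul_le_iff_mem_transporter.2 fun c hc => by
      rw [Ideal.mem_bot.1 hc, smul_zero]
      exact zero_mem _)
  obtain ⟨y, hy, hy0⟩ := Submodule.exists_mem_ne_zero_of_ne_bot hI0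
  obtain ⟨E, hEfin, hET, hE⟩ := hR.exists_finite_of_mul_mem (single 1 y)
    (coeffSubgroup p (transporter G I p)) fun b hb r hr =>
      coeff_mul_mem_of_mem_idealiser hI subset_rfl (fun _ hg _ hk => mul_mem_transporter hg hk)
        hb hr
  let F : Set G := ⋃ b ∈ E, b.support
  refine ⟨F, hEfin.biUnion fun b _ => Finset.finite_toSet _, fun g hg => ?_⟩
  have hyg : single 1 y * single g 1 ∈
      idealiser (B := SkewMonoidAlgebra C G) (extendedRightIdeal G I) :=
    mem_idealiser_of_mem ((extendedRightIdeal G I).smul_mem (op (single g 1))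
      (Submodule.subset_span ⟨y, hy, rfl⟩))
  have hg1 : (single g 1 : SkewMonoidAlgebra C G) ∈ coeffSubgroup p (transporter G I p) := by
    classical
    intro x hx
    rw [coeff_single, Finsupp.single_apply, if_neg]
    · exact p.zero_mem
    · rintro rfl
      exact hx hg
  obtain ⟨b, hb, h⟩ := hE
    (coeffSubgroup p (transporter G I p ∩ (F * (MulAction.stabilizer G I : Set G))))
    (fun b hb r hr => coeff_mul_mem_of_mem_idealiser hI Set.inter_subset_left
      (by
        rintro g ⟨hg, f, hf, k', hk', rfl⟩ k hk
        exact ⟨mul_mem_transporter hg hk, f, hf, k' * k,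
          (MulAction.stabilizer G I).mul_mem hk' hk, (mul_assoc _ _ _).symm⟩) hb hr)
    (fun b hb g hg => by
      by_cases hgT : g ∈ transporter G I p
      · have : b.coeff g = 0 := by
          by_contra h
          exact hg ⟨hgT, g, Set.mem_biUnion hb (mem_support_iff.2 h), 1,
            (MulAction.stabilizer G I).one_mem, mul_one g⟩
        rw [this]
        exact p.zero_mem
      · exact hET hb g hgT) _ hg1 hyg
  -- Cancelling y in the domain C gives `b` the coefficient 1 at g, which would lie in p if g were
  -- outside the cosets fK.
  by_contra hgF
  have h1 := DFunLike.congr_fun (congrArg coeff h) g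
  rw [coeff_single_one_mul, coeff_single_one_mul, coeff_single, Finsupp.single_eq_same] at h1
  refine hp.ne_top ((Ideal.eq_top_iff_one p).2 ?_)
  rw [mul_left_cancel₀ hy0 h1]
  exact hb g fun hg' => hgF hg'.2

/-! ### Comparison of cosets of the stabiliser with complementary subgroups. -/

lemma IsComplementary.exists_finite_transporter_subset {I : Ideal C} {H : Subgroup G}
    (hH : IsComplementary H (MulAction.stabilizer G I))
    (hfin : ∀ p : PrimeSpectrum C, (transporterSet I H p).Finite) {p : Ideal C} (hp : p.IsPrime) :
    ∃ F : Set G, F.Finite ∧ transporter G I p ⊆ F * (MulAction.stabilizer G I : Set G) := by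
  obtain ⟨-, t, ht⟩ := hH
  -- The point `q a` is a⁻¹ • p: for g = ahk, the inclusion g • I ⊆ p means h • I ⊆ a⁻¹ • p.
  -- Finiteness is thus used at several points for a single p.
  let q (a : G) : PrimeSpectrum C := ⟨p.comap (MulSemiringAction.toRingHom G C a), hp.comap _⟩
  refine ⟨⋃ a ∈ t, (a * ·) '' transporterSet I H (q a),
    t.finite_toSet.biUnion fun a _ => (hfin (q a)).image _, fun g hg => ?_⟩
  obtain ⟨a, ha, h, hh, k, hk, rfl⟩ := ht g
  refine ⟨a * h, Set.mem_biUnion ha ⟨h, ⟨hh, ?_⟩, rfl⟩, k, hk, rfl⟩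
  refine smul_le_iff_mem_transporter.2 fun c hc => ?_
  have := mul_mem_transporter hg ((MulAction.stabilizer G I).inv_mem hk) c hc
  rwa [mul_inv_cancel_right, mul_smul] at this

/-- As H ∩ K is trivial, distinct elements of `H` lie in distinct left cosets of K. -/
lemma finite_transporterSet {I : Ideal C} {H : Subgroup G}
    (hH : H ⊓ MulAction.stabilizer G I = ⊥) {p : PrimeSpectrum C} {F : Set G} (hF : F.Finite)
    (hsub : transporter G I p.asIdeal ⊆ F * (MulAction.stabilizer G I : Set G)) :
    (transporterSet I H p).Finite := by
  have hex : ∀ h ∈ transporterSet I H p, ∃ f ∈ F, f⁻¹ * h ∈ MulAction.stabilizer G I := by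
    rintro h ⟨-, hh⟩
    obtain ⟨f, hf, k, hk, rfl⟩ := hsub (smul_le_iff_mem_transporter.1 hh)
    exact ⟨f, hf, by simpa using hk⟩
  choose! f hf hfK using hex
  refine Set.Finite.of_injOn hf (fun h hh h' hh' e => ?_) hF
  have hmem : h⁻¹ * h' ∈ H ⊓ MulAction.stabilizer G I := by
    refine ⟨H.mul_mem (H.inv_mem hh.1) hh'.1, ?_⟩
    have := (MulAction.stabilizer G I).mul_mem ((MulAction.stabilizer G I).inv_mem (hfK h hh))
      (hfK h' hh')
    rw [e] at this
    simpa [mul_assoc] using this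
  rw [hH, Subgroup.mem_bot] at hmem
  exact inv_mul_eq_one.1 hmem

end IdealiserSkew

open IdealiserSkew in
theorem theoremR {C G : Type*} [CommRing C] [IsDomain C] [IsNoetherianRing C]
    [Group G] (hG : IsPolycyclicByFinite G) [MulSemiringAction G C]
    (I : Ideal C) (hI : I.IsPrime)
    (hK : ∃ H : Subgroup G, IsComplementary H (MulAction.stabilizer G I)) :
    List.TFAE [
      ∃ H : Subgroup G, IsComplementary H (MulAction.stabilizer G I) ∧
        ∀ p : PrimeSpectrum C, (transporterSet I H p).Finite,
      IsRightNoetherian (idealiser (extendedRightIdeal G I)),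
      ∀ H : Subgroup G, IsComplementary H (MulAction.stabilizer G I) →
        ∀ p : PrimeSpectrum C, (transporterSet I H p).Finite] := by
  tfae_have 1 → 2 := fun ⟨_, hH, hfin⟩ =>
    isRightNoetherian_idealiser hG fun _ hp => hH.exists_finite_transporter_subset hfin hp
  tfae_have 2 → 3 := fun hR _ hH p =>
    have ⟨_, hF, hsub⟩ := exists_finite_transporter_subset hI hR p.isPrime
    finite_transporterSet hH.1 hF hsub
  tfae_have 3 → 1 := fun h => hK.imp fun H hH => ⟨hH, h H hH⟩
  tfae_finish
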